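/- Let $V$ be an infinite set and let $(c_v)_{v\in V}$ be points of the Euclidean plane such that the open disks $B(c_v,\tfrac12)$ ("pennies") are pairwise disjoint. The associated penny graph $G$ has vertex set $V$, with $v\sim w$ if and only if the circles of radius $\tfrac12$ about $c_v$ and $c_w$ are tangent, i.e. $|c_v-c_w|=1$. Assume that $G$ is connected; let $d$ be its combinatorial distance and, for $x\in V$ and real $R\ge 0$, let $|B_R(x)|$ be the number of vertices $y$ with $d(y,x)\le R$. Draw $G$ in the plane by the points $c_v$ and the segments joining $c_v$ to $c_w$ for $v\sim w$. The faces of $G$ are the connected components of the complement of this drawing. The facial degree of a face $\sigma$ is the number, in $\mathbb N\cup\{\infty\}$, of its corners (interior angles), where a corner of $\sigma$ at $v$ is a connected component of $\sigma\cap B(c_v,\tfrac12)$, i.e. an open circular sector between consecutive edges at $v$ (straight angles are counted, and a vertex of degree one gives a single corner of angle $2\pi$). **Theorem.** For every $D\in\mathbb N$ there are positive constants $C_1,C_2,C_3,C_4$, depending only on $D$, such that for every infinite connected penny graph $G$ all of whose faces have facial degree at most $D$: 1. (volume doubling) $|B_{2R}(x)|\le C_1\,|B_R(x)|$ for all $x\in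 V$ and $R>0$; 2. (weak relative volume comparison with exponent $\nu=2$) $\dfrac{|B_R(x)|}{|B_r(x)|}\le C_2\left(\dfrac Rr\right)^{2}$ for all $x\in V$ and $R>r>0$; 3. (quadratic volume growth) $|B_R(x)|$ is finite and $C_3R^2\le |B_R(x)|\le C_4R^2$ for all $x\in V$ and $R\ge 1$. -/

import Mathlib

/-- The Euclidean plane. -/
abbrev Plane : Type := EuclideanSpace ℝ (Fin 2)

/-- A configuration of pennies indexed by `V`: open disks of radius `1/2` in the plane which are
pairwise disjoint. -/
structure PennyConfiguration (V : Type*) where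
  /-- the center of each penny -/
  center : V → Plane
  pairwise_disjoint : Pairwise fun i j : V =>
    Disjoint (Metric.ball (center i) (1 / 2)) (Metric.ball (center j) (1 / 2))

namespace PennyConfiguration

variable {V : Type*} (P : PennyConfiguration V)

/-- The open disk (penny) with index `v`. -/
def penny (v : V) : Set Plane := Metric.ball (P.center v) (1 / 2)

/-- The contact graph. Two circles of radius `1/2` bounding disjoint disks are tangent exactly when
the distance of their centers is `1`. -/
def graph : SimpleGraph V where
  Adj v w := dist (P.center v) (P.center w) = 1
  symm := ⟨fun v w h => by rw [dist_comm]; exact h⟩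
  loopless := ⟨fun v h => by simp at h⟩

/-- The image of the vertices and edges in the plane: the centers of the pennies, and the segments
joining the centers of tangent pennies. -/
def drawing : Set Plane :=
  Set.range P.center ∪
    {p | ∃ v w : V, P.graph.Adj v w ∧ p ∈ segment ℝ (P.center v) (P.center w)}

/-- The faces: the connected components of the complement of the drawing. -/
def faces : Set (Set Plane) :=
  {σ | ∃ p ∈ P.drawingᶜ, σ = connectedComponentIn P.drawingᶜ p}

/-- The corners (interior angles) of a face `σ`. The penny at `v` meets the drawing only in the
radii lying on the edges at `v`, so these radii cut it into open circular sectors. The corners of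
`σ` at `v` are those of these sectors that lie in `σ`, which are the connected components of
`σ ∩ P.penny v`. A straight angle is a corner, and the slit disk at a vertex of degree one
is a corner of angle `2π`. -/
def corners (σ : Set Plane) : Set (Set Plane) :=
  {s | ∃ v : V, ∃ p ∈ σ ∩ P.penny v, s = connectedComponentIn (σ ∩ P.penny v) p}

/-- The facial degree: the number of corners, in `ℕ ∪ {∞}`. -/
noncomputable def facialDegree (σ : Set Plane) : ℕ∞ := (P.corners σ).encard

end PennyConfiguration

namespace SimpleGraph

variable {V : Type*} (G : SimpleGraph V)

/-- The closed ball of radius `R` about `x` in the combinatorial distance (of a connected graph). -/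
def combBall (x : V) (R : ℝ) : Set V := {y | (G.dist y x : ℝ) ≤ R}

/-- The number of vertices in the ball of radius `R` about `x` (for a graph with finite balls). -/
noncomputable def vol (x : V) (R : ℝ) : ℝ := ((G.combBall x R).ncard : ℝ)

/-- The volume doubling property with constant `C`. -/
def VolumeDoubling (C : ℝ) : Prop :=
  ∀ (x : V) (R : ℝ), 0 < R → G.vol x (2 * R) ≤ C * G.vol x R

/-- The weak relative volume comparison with constant `C` and exponent `ν`. -/
def WeakRelativeVolumeComparison (C ν : ℝ) : Prop :=
  ∀ (x : V) (R r : ℝ), 0 < r → r < R → G.vol x R / G.vol x r ≤ C * (R / r) ^ ν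

end SimpleGraph

open Set Metric Topology MeasureTheory

/-! The point is that combinatorial and Euclidean distance are comparable at large scale; volumes
are then compared by area. Edges have length one, so combinatorial balls lie in Euclidean balls of
the same radius, and packing disjoint pennies gives the quadratic upper bound.

For the lower bound, let a face touch a penny when it meets it. Corners at different vertices are
distinct, so a face touches at most `D` pennies. The complement of a face is connected because the
graph is, so by unicoherence of the plane the overlap of thin neighbourhoods of the face and of its
complement is connected. Slightly enlarged touched pennies cover this overlap, hence they form a
chain and the touched vertices are within graph distance `D` (`graph_dist_le_of_touching`). As the
graph is infinite, every face is then bounded in terms of `D` (`faceAt_subset_closedBall`).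

The open sets `region v`, near which every face touches `v`, cover the plane. A unit segment meets
boundedly many of them, and overlapping ones have labels within distance `D`, so graph distance is
at most linear in Euclidean distance (`graph_dist_le_of_dist_le`). Disks of radius `D + 1` about a
combinatorial ball of radius `R` thus cover a Euclidean disk of radius comparable to `R`, for large
`R`. -/

/-! ### Connectedness: frontiers, unicoherence, chains of open sets -/

/-- A preconnected set meeting both a set and its complement meets its frontier. -/
theorem IsPreconnected.exists_mem_frontier {X : Type*} [TopologicalSpace X] {s t : Set X}
    (ht : IsPreconnected t) (h₁ : (t ∩ s).Nonempty) (h₂ : (t ∩ sᶜ).Nonempty) :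
    (t ∩ frontier s).Nonempty := by
  by_contra hne
  rw [not_nonempty_iff_eq_empty] at hne
  have hf : ∀ x ∈ t, x ∉ frontier s := fun x hx hx' =>
    (eq_empty_iff_forall_notMem.1 hne x) ⟨hx, hx'⟩
  obtain ⟨x, hx, hxs⟩ := h₁
  obtain ⟨y, hy, hys⟩ := h₂
  have hcov : t ⊆ interior s ∪ (closure s)ᶜ := by
    intro z hz
    by_cases hzc : z ∈ closure s
    · left
      by_contra hzi
      exact hf z hz ⟨hzc, hzi⟩
    · exact Or.inr hzc
  have hx' : x ∈ interior s := (hcov hx).resolve_right fun h => h (subset_closure hxs)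
  have hy' : y ∈ (closure s)ᶜ := (hcov hy).resolve_left fun h => hys (interior_subset h)
  obtain ⟨z, -, hz₁, hz₂⟩ := ht _ _ isOpen_interior isClosed_closure.isOpen_compl hcov
    ⟨x, hx, hx'⟩ ⟨y, hy, hy'⟩
  exact hz₂ (subset_closure (interior_subset hz₁))

/-- Unicoherence of simply connected spaces: if two open connected sets cover the space,
their intersection is connected. -/
theorem IsPreconnected.inter_of_union_eq_univ {X : Type*} [TopologicalSpace X] [NormalSpace X]
    [SimplyConnectedSpace X] [LocallyPathConnectedSpace X] {U V : Set X} (hU : IsOpen U)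
    (hV : IsOpen V) (hUc : IsPreconnected U) (hVc : IsPreconnected V) (hUV : U ∪ V = univ) :
    IsPreconnected (U ∩ V) := by
  classical
  rintro A₀ B₀ hA₀ hB₀ hcov ⟨a, ha, haA⟩ ⟨b, hb, hbB⟩
  by_contra hne
  rw [not_nonempty_iff_eq_empty, eq_empty_iff_forall_notMem] at hne
  set A : Set X := U ∩ V ∩ A₀ with hAdef
  set B : Set X := U ∩ V ∩ B₀ with hBdef
  have hA : IsOpen A := (hU.inter hV).inter hA₀
  have hB : IsOpen B := (hU.inter hV).inter hB₀
  have hAB : ∀ x ∈ A, x ∉ B := fun x hx hx' => hne x ⟨hx.1, hx.2, hx'.2⟩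
  have hcov' : ∀ x, x ∈ U → x ∈ V → x ∉ A → x ∈ B := by
    intro x hxU hxV hxA
    rcases hcov ⟨hxU, hxV⟩ with h | h
    · exact absurd ⟨⟨hxU, hxV⟩, h⟩ hxA
    · exact ⟨⟨hxU, hxV⟩, h⟩
  have hor : ∀ x, x ∈ U ∨ x ∈ V := fun x => by
    have : x ∈ U ∪ V := hUV ▸ mem_univ x
    exact this
  obtain ⟨f, hf0, hf1, -⟩ := exists_continuous_zero_one_of_isClosed hV.isClosed_compl
    hU.isClosed_compl (by
      rw [Set.disjoint_left]
      intro x hxV hxU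
      exact (hor x).elim hxU hxV)
  -- If `U ∩ V` splits into open `A` and `B`, then `φ` is continuous on `U`, `ψ` on `V`, and they
  -- differ by integers. They glue to a circle-valued map that would wind once around a loop from
  -- `A` to `B` through `U` and back through `V`.
  let φ : X → ℝ := fun x => if x ∈ A then f x else 0
  let ψ : X → ℝ := fun x => if x ∈ A then f x - 1 else 0
  have hφ : ∀ x ∈ U, ContinuousAt φ x := by
    intro x hx
    by_cases hxA : x ∈ A
    · refine f.continuous.continuousAt.congr ?_
      filter_upwards [hA.mem_nhds hxA] with y hy
      simp [φ, hy]
    by_cases hxV : x ∈ V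
    · refine (continuousAt_const (y := (0 : ℝ))).congr ?_
      filter_upwards [hB.mem_nhds (hcov' x hx hxV hxA)] with y hy
      have : y ∉ A := fun h => hAB y h hy
      simp [φ, this]
    · have h0 : f x = 0 := hf0 hxV
      have hφx : φ x = 0 := by simp [φ, hxA]
      rw [ContinuousAt, hφx]
      have hfx : Filter.Tendsto (fun y => |f y|) (𝓝 x) (𝓝 0) := by
        have := (f.continuous.continuousAt (x := x)).tendsto.abs
        simpa [h0] using this
      refine squeeze_zero_norm (fun y => ?_) hfx
      by_cases hy : y ∈ A <;> simp [φ, hy]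
  have hψ : ∀ x ∈ V, ContinuousAt ψ x := by
    intro x hx
    by_cases hxA : x ∈ A
    · refine (f.continuous.continuousAt.sub (continuousAt_const (y := (1 : ℝ)))).congr ?_
      filter_upwards [hA.mem_nhds hxA] with y hy
      simp [ψ, hy]
    by_cases hxU : x ∈ U
    · refine (continuousAt_const (y := (0 : ℝ))).congr ?_
      filter_upwards [hB.mem_nhds (hcov' x hxU hx hxA)] with y hy
      have : y ∉ A := fun h => hAB y h hy
      simp [ψ, this]
    · have h1 : f x = 1 := hf1 hxU
      have hψx : ψ x = 0 := by simp [ψ, hxA]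
      rw [ContinuousAt, hψx]
      have hfx : Filter.Tendsto (fun y => |f y - 1|) (𝓝 x) (𝓝 0) := by
        have := ((f.continuous.continuousAt (x := x)).tendsto.sub_const 1).abs
        simpa [h1] using this
      refine squeeze_zero_norm (fun y => ?_) hfx
      by_cases hy : y ∈ A <;> simp [ψ, hy]
  have hφψ : ∀ x, ((φ x : ℝ) : AddCircle (1 : ℝ)) = ((ψ x : ℝ) : AddCircle (1 : ℝ)) := by
    intro x
    by_cases hx : x ∈ A
    · simp only [φ, ψ, hx, if_true]
      rw [AddCircle.coe_sub, AddCircle.coe_period, sub_zero]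
    · simp [φ, ψ, hx]
  have hg : Continuous fun x => ((φ x : ℝ) : AddCircle (1 : ℝ)) := by
    rw [continuous_iff_continuousAt]
    intro x
    rcases hor x with hx | hx
    · exact (AddCircle.continuous_mk' (1 : ℝ)).continuousAt.comp (hφ x hx)
    · simp_rw [hφψ]
      exact (AddCircle.continuous_mk' (1 : ℝ)).continuousAt.comp (hψ x hx)
  -- Simple connectedness gives a real lift `θ`. Both `φ - θ` on `U` and `ψ - θ` on `V` are
  -- integer-valued, hence constant; comparing `a ∈ A` with `b ∈ B` gives `f a = f a - 1`.
  obtain ⟨θ, ⟨-, hθ⟩, -⟩ := (AddCircle.isCoveringMap_coe (1 : ℝ)).existsUnique_continuousMap_lifts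
    ⟨_, hg⟩ a (φ a) rfl
  have hθ' : ∀ x, ((θ x : ℝ) : AddCircle (1 : ℝ)) = ((φ x : ℝ) : AddCircle (1 : ℝ)) :=
    fun x => congrFun hθ x
  have hdisc : IsDiscrete ((AddSubgroup.zmultiples (1 : ℝ) : AddSubgroup ℝ) : Set ℝ) :=
    ⟨inferInstanceAs (DiscreteTopology (AddSubgroup.zmultiples (1 : ℝ)))⟩
  have hmem : ∀ u v : ℝ, (u : AddCircle (1 : ℝ)) = (v : AddCircle (1 : ℝ)) →
      v - u ∈ ((AddSubgroup.zmultiples (1 : ℝ) : AddSubgroup ℝ) : Set ℝ) := by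
    intro u v huv
    have : ((v - u : ℝ) : AddCircle (1 : ℝ)) = 0 := by rw [AddCircle.coe_sub, huv, sub_self]
    rw [AddCircle.coe_eq_zero_iff] at this
    exact AddSubgroup.mem_zmultiples_iff.2 this
  have e₁ : φ a - θ a = φ b - θ b :=
    hUc.constant_of_mapsTo hdisc (f := fun x => φ x - θ x)
      (fun x hx => ((hφ x hx).sub θ.continuous.continuousAt).continuousWithinAt)
      (fun x _ => hmem _ _ (hθ' x)) ha.1 hb.1
  have e₂ : ψ a - θ a = ψ b - θ b :=
    hVc.constant_of_mapsTo hdisc (f := fun x => ψ x - θ x)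
      (fun x hx => ((hψ x hx).sub θ.continuous.continuousAt).continuousWithinAt)
      (fun x _ => hmem _ _ ((hθ' x).trans (hφψ x))) ha.2 hb.2
  have haA' : a ∈ A := ⟨ha, haA⟩
  have hbA' : b ∉ A := fun h => hAB b h ⟨hb, hbB⟩
  simp only [φ, ψ, haA', hbA', if_true, if_false] at e₁ e₂
  linarith

/-- If finitely many open sets, each meeting a preconnected set `U`, cover `U`, and if overlapping
sets carry labels at distance at most `k` in a connected graph, then all labels are at distance at
most `k` times the number of sets. -/
theorem SimpleGraph.Connected.dist_le_of_cover {V X ι : Type*} [TopologicalSpace X] [Finite ι]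
    {G : SimpleGraph V} (hG : G.Connected) {U : Set X} (hU : IsPreconnected U) {O : ι → Set X}
    (hO : ∀ i, IsOpen (O i)) (hcov : U ⊆ ⋃ i, O i) (hne : ∀ i, (U ∩ O i).Nonempty)
    {f : ι → V} {k : ℕ} (h : ∀ i j, (O i ∩ O j).Nonempty → G.dist (f i) (f j) ≤ k) (i j : ι) :
    G.dist (f i) (f j) ≤ k * Nat.card ι := by
  classical
  have := Fintype.ofFinite ι
  let H : SimpleGraph ι := SimpleGraph.fromRel fun i j => (O i ∩ O j).Nonempty
  have hH : ∀ i j, H.Adj i j → G.dist (f i) (f j) ≤ k := by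
    intro i j hij
    rw [SimpleGraph.fromRel_adj] at hij
    rcases hij.2 with h' | h'
    · exact h i j h'
    · exact h i j (by rwa [inter_comm])
  have hwalk : ∀ {i j : ι} (p : H.Walk i j), G.dist (f i) (f j) ≤ k * p.length := by
    intro i j p
    induction p with
    | nil => simp
    | cons hadj p ih =>
      rw [SimpleGraph.Walk.length_cons]
      calc _ ≤ _ := hG.dist_triangle
        _ ≤ k + k * p.length := add_le_add (hH _ _ hadj) ih
        _ = _ := by ring
  -- Otherwise the sets reachable from `i` and the remaining ones would separate `U`.
  have hreach : H.Reachable i j := by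
    by_contra hij
    obtain ⟨x, -, hx₁, hx₂⟩ := hU (⋃ l ∈ {l | H.Reachable i l}, O l)
      (⋃ l ∈ {l | ¬ H.Reachable i l}, O l) (isOpen_biUnion fun l _ => hO l)
      (isOpen_biUnion fun l _ => hO l)
      (fun x hx => by
        obtain ⟨l, hl⟩ := mem_iUnion.1 (hcov hx)
        by_cases hil : H.Reachable i l
        · exact Or.inl (mem_biUnion hil hl)
        · exact Or.inr (mem_biUnion hil hl))
      (by
        obtain ⟨x, hxU, hx⟩ := hne i
        exact ⟨x, hxU, mem_biUnion (x := i) (SimpleGraph.Reachable.refl i) hx⟩)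
      (by
        obtain ⟨x, hxU, hx⟩ := hne j
        exact ⟨x, hxU, mem_biUnion (x := j) hij hx⟩)
    obtain ⟨l, hl, hxl⟩ := mem_iUnion₂.1 hx₁
    obtain ⟨m, hm, hxm⟩ := mem_iUnion₂.1 hx₂
    refine hm ((hl : H.Reachable i l).trans (SimpleGraph.Adj.reachable ?_))
    rw [SimpleGraph.fromRel_adj]
    refine ⟨?_, Or.inl ⟨x, hxl, hxm⟩⟩
    rintro rfl
    exact hm hl
  obtain ⟨p⟩ := hreach
  refine (hwalk p.toPath.1).trans (Nat.mul_le_mul_left k ?_)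
  rw [Nat.card_eq_fintype_card]
  exact p.toPath.2.length_lt.le

/-! ### Disks in the plane: exteriors and areas -/

theorem Plane.finrank_eq : Module.finrank ℝ Plane = 2 := by simp

/-- The exterior is the image of the punctured plane under pushing each point outwards by `r`. -/
theorem Plane.isPreconnected_compl_closedBall (c : Plane) {r : ℝ} (hr : 0 ≤ r) :
    IsPreconnected (closedBall c r)ᶜ := by
  have h : IsPreconnected ({0}ᶜ : Set Plane) := by
    refine (isConnected_compl_singleton_of_one_lt_rank ?_ 0).isPreconnected
    rw [← Module.finrank_eq_rank, Plane.finrank_eq]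
    norm_num
  have hcont : ContinuousOn (fun x : Plane => c + (1 + r / ‖x‖) • x) {0}ᶜ := by
    have h₁ : ContinuousOn (fun x : Plane => 1 + r / ‖x‖) {0}ᶜ := by
      refine continuousOn_const.add (continuousOn_const.div continuous_norm.continuousOn ?_)
      intro x hx
      simpa using hx
    exact continuousOn_const.add (h₁.smul continuousOn_id)
  convert h.image _ hcont using 1
  ext y
  simp only [mem_compl_iff, mem_closedBall, not_le, mem_image, mem_singleton_iff]
  constructor
  · intro hy
    have hpos : 0 < ‖y - c‖ := by rw [← dist_eq_norm]; linarith
    have hlt : r < ‖y - c‖ := by rwa [← dist_eq_norm]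
    have hdiv : 0 < 1 - r / ‖y - c‖ := by rw [sub_pos, div_lt_one hpos]; exact hlt
    have hnorm : ‖(1 - r / ‖y - c‖) • (y - c)‖ = ‖y - c‖ - r := by
      rw [norm_smul, Real.norm_of_nonneg hdiv.le]
      field_simp
    refine ⟨(1 - r / ‖y - c‖) • (y - c), ?_, ?_⟩
    · refine norm_pos_iff.1 ?_
      rw [hnorm]
      linarith
    · rw [hnorm, smul_smul]
      have : (1 + r / (‖y - c‖ - r)) * (1 - r / ‖y - c‖) = 1 := by
        have : ‖y - c‖ - r ≠ 0 := by linarith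
        field_simp
        ring
      rw [this, one_smul]
      abel
  · rintro ⟨x, hx, rfl⟩
    have hpos : 0 < ‖x‖ := norm_pos_iff.2 hx
    rw [dist_eq_norm, add_sub_cancel_left, norm_smul, Real.norm_of_nonneg (by positivity)]
    have : (1 + r / ‖x‖) * ‖x‖ = ‖x‖ + r := by field_simp
    linarith

theorem Plane.volume_real_ball (c : Plane) {r : ℝ} (hr : 0 ≤ r) :
    volume.real (ball c r) = r ^ 2 * volume.real (ball (0 : Plane) 1) := by
  rw [Measure.real, Measure.addHaar_ball volume c hr, Plane.finrank_eq, ENNReal.toReal_mul,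
    ENNReal.toReal_ofReal (by positivity), Measure.real]

theorem Plane.volume_real_closedBall (c : Plane) {r : ℝ} (hr : 0 ≤ r) :
    volume.real (closedBall c r) = r ^ 2 * volume.real (ball (0 : Plane) 1) := by
  rw [Measure.real, Measure.addHaar_closedBall volume c hr, Plane.finrank_eq, ENNReal.toReal_mul,
    ENNReal.toReal_ofReal (by positivity), Measure.real]

theorem Plane.volume_real_unit_ball_pos : 0 < volume.real (ball (0 : Plane) 1) :=
  ENNReal.toReal_pos (measure_ball_pos volume _ one_pos).ne' measure_ball_lt_top.ne

/-! ### Packing and covering bounds by area -/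

namespace PennyConfiguration

variable {V : Type*} (P : PennyConfiguration V)

theorem one_le_dist {v w : V} (h : v ≠ w) : 1 ≤ dist (P.center v) (P.center w) := by
  by_contra! hlt
  have hd := P.pairwise_disjoint h
  refine Set.disjoint_left.1 hd (?_ : midpoint ℝ (P.center v) (P.center w) ∈ _) ?_
  · rw [mem_ball, dist_midpoint_left, Real.norm_of_nonneg (by norm_num)]
    linarith
  · rw [mem_ball, dist_midpoint_right, Real.norm_of_nonneg (by norm_num)]
    linarith

/-- The disjoint pennies of radius `1 / 2` all fit in the disk of radius `L + 1 / 2`. -/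
theorem card_le_of_subset_closedBall {p : Plane} {L : ℝ} (hL : 0 ≤ L) (t : Finset V)
    (ht : ∀ v ∈ t, P.center v ∈ closedBall p L) : (t.card : ℝ) ≤ (2 * L + 1) ^ 2 := by
  have h₁ : volume.real (⋃ v ∈ t, P.penny v) ≤ volume.real (ball p (L + 1 / 2)) := by
    refine measureReal_mono (iUnion₂_subset fun v hv x hx => ?_) measure_ball_lt_top.ne
    have := ht v hv
    simp only [penny, mem_ball, mem_closedBall] at this hx ⊢
    linarith [dist_triangle x (P.center v) p]
  rw [measureReal_biUnion_finset (f := P.penny) (fun v _ w _ hvw => P.pairwise_disjoint hvw)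
    (fun v _ => measurableSet_ball) (fun v _ => measure_ball_lt_top.ne)] at h₁
  simp only [penny] at h₁
  rw [Finset.sum_congr rfl fun v _ => Plane.volume_real_ball (P.center v) (r := 1 / 2)
    (by norm_num), Plane.volume_real_ball p (r := L + 1 / 2) (by linarith), Finset.sum_const, nsmul_eq_mul,
    ← mul_assoc] at h₁
  have := le_of_mul_le_mul_right h₁ Plane.volume_real_unit_ball_pos
  nlinarith

theorem finite_center_mem_closedBall (p : Plane) (L : ℝ) :
    {v | P.center v ∈ closedBall p L}.Finite := by
  rcases lt_or_ge L 0 with hL | hL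
  · simp [closedBall_eq_empty.2 hL]
  by_contra hinf
  obtain ⟨n, hn⟩ := exists_nat_gt ((2 * L + 1) ^ 2)
  obtain ⟨t, ht, hcard⟩ := Set.Infinite.exists_subset_card_eq hinf n
  have := P.card_le_of_subset_closedBall hL t fun v hv => ht hv
  rw [hcard] at this
  linarith

theorem ncard_center_mem_closedBall_le (p : Plane) {L : ℝ} (hL : 0 ≤ L) :
    ({v | P.center v ∈ closedBall p L}.ncard : ℝ) ≤ (2 * L + 1) ^ 2 := by
  rw [Set.ncard_eq_toFinset_card _ (P.finite_center_mem_closedBall p L)]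
  exact P.card_le_of_subset_closedBall hL _ fun v hv => by simpa using hv

theorem sq_le_ncard_mul_sq {p : Plane} {L r : ℝ} (hL : 0 ≤ L) (hr : 0 ≤ r) {s : Set V}
    (hs : s.Finite) (hcov : ball p L ⊆ ⋃ v ∈ s, closedBall (P.center v) r) :
    L ^ 2 ≤ s.ncard * r ^ 2 := by
  rw [Set.ncard_eq_toFinset_card _ hs]
  have hcov' : ball p L ⊆ ⋃ v ∈ hs.toFinset, closedBall (P.center v) r := by simpa using hcov
  have h := (measureReal_mono hcov' (μ := volume) (by
      refine ((measure_biUnion_finset_le _ _).trans_lt ?_).ne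
      exact ENNReal.sum_lt_top.2 fun v _ => measure_closedBall_lt_top)).trans
    (measureReal_biUnion_finset_le _ _)
  rw [Finset.sum_congr rfl fun v _ => Plane.volume_real_closedBall (P.center v) hr,
    Plane.volume_real_ball _ hL, Finset.sum_const, nsmul_eq_mul, ← mul_assoc] at h
  exact le_of_mul_le_mul_right h Plane.volume_real_unit_ball_pos

end PennyConfiguration

/-! ### Thickenings and segments -/

theorem IsPreconnected.thickening {X : Type*} [NormedAddCommGroup X] [NormedSpace ℝ X] {s : Set X}
    (hs : IsPreconnected s) {ε : ℝ} (hε : 0 < ε) : IsPreconnected (thickening ε s) := by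
  rcases s.eq_empty_or_nonempty with rfl | ⟨x₀, hx₀⟩
  · simpa using isPreconnected_empty
  refine isPreconnected_of_forall x₀ fun y hy => ?_
  obtain ⟨x, hx, hyx⟩ := mem_thickening_iff.1 hy
  refine ⟨s ∪ ball x ε, union_subset (self_subset_thickening hε s) (ball_subset_thickening hx ε),
    Or.inl hx₀, Or.inr hyx, ?_⟩
  exact hs.union x hx (mem_ball_self hε) (convex_ball x ε).isPreconnected

/-- A two-segment Stewart identity: it reduces separation of edges to the lower bound `1` on
distances between centers. -/
theorem Plane.dist_sq_lineMap (a b v w : Plane) (s t : ℝ) :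
    dist (a + s • (b - a)) (v + t • (w - v)) ^ 2 =
      (1 - s) * (1 - t) * dist a v ^ 2 + (1 - s) * t * dist a w ^ 2 +
        s * (1 - t) * dist b v ^ 2 + s * t * dist b w ^ 2 -
        s * (1 - s) * dist a b ^ 2 - t * (1 - t) * dist v w ^ 2 := by
  simp only [dist_eq_norm, EuclideanSpace.real_norm_sq_eq, Fin.sum_univ_two, PiLp.sub_apply,
    PiLp.add_apply, PiLp.smul_apply, smul_eq_mul]
  ring

theorem Plane.volume_segment (a b : Plane) : volume (segment ℝ a b) = 0 := by
  refine measure_mono_null (t := (affineSpan ℝ {a, b} : Set Plane)) ?_ ?_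
  · rw [← convexHull_pair]
    exact convexHull_subset_affineSpan _
  · refine Measure.addHaar_affineSubspace _ _ fun h => ?_
    have h₁ := (collinear_pair ℝ a b).finrank_le_one
    rw [← direction_affineSpan, h, AffineSubspace.direction_top, finrank_top,
      Plane.finrank_eq] at h₁
    norm_num at h₁

/-! ### The drawing: closed, with dense complement, connected, with separated edges -/

namespace PennyConfiguration

variable {V : Type*} (P : PennyConfiguration V)

theorem adj_iff_dist {v w : V} : P.graph.Adj v w ↔ dist (P.center v) (P.center w) = 1 := Iff.rfl

theorem adj_of_dist_le {v w : V} (hne : v ≠ w) (h : dist (P.center v) (P.center w) ≤ 1) :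
    P.graph.Adj v w :=
  le_antisymm h (P.one_le_dist hne)

theorem graph_dist_le_one {v w : V} (h : dist (P.center v) (P.center w) ≤ 1) :
    P.graph.dist v w ≤ 1 := by
  rcases eq_or_ne v w with rfl | hne
  · simp
  · exact (SimpleGraph.dist_eq_one_iff_adj.2 (P.adj_of_dist_le hne h)).le

theorem dist_center_le_graph_dist (hconn : P.graph.Connected) (v w : V) :
    dist (P.center v) (P.center w) ≤ P.graph.dist v w := by
  obtain ⟨p, hp⟩ := hconn.exists_walk_length_eq_dist v w
  rw [← hp]
  clear hp
  induction p with
  | nil => simp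
  | cons hadj p ih =>
    rw [SimpleGraph.Walk.length_cons]
    push_cast
    have := P.adj_iff_dist.1 hadj
    exact (dist_triangle _ _ _).trans (by linarith)

theorem center_mem_drawing (v : V) : P.center v ∈ P.drawing := Or.inl ⟨v, rfl⟩

theorem segment_subset_drawing {v w : V} (h : P.graph.Adj v w) :
    segment ℝ (P.center v) (P.center w) ⊆ P.drawing := fun _ hp => Or.inr ⟨v, w, h, hp⟩

/-- Pairs of vertices that are equal or adjacent. -/
def ShortPair : Type _ := {x : V × V // dist (P.center x.1) (P.center x.2) ≤ 1}

/-- The degenerate pairs `(v, v)` supply the centers, so later arguments treat segments only. -/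
theorem drawing_eq_iUnion :
    P.drawing = ⋃ x : P.ShortPair, segment ℝ (P.center x.1.1) (P.center x.1.2) := by
  ext p
  simp only [mem_iUnion]
  constructor
  · rintro (⟨v, rfl⟩ | ⟨v, w, h, hp⟩)
    · exact ⟨⟨(v, v), by simp⟩, left_mem_segment ..⟩
    · exact ⟨⟨(v, w), (P.adj_iff_dist.1 h).le⟩, hp⟩
  · rintro ⟨⟨⟨v, w⟩, h⟩, hp⟩
    rcases eq_or_ne v w with rfl | hne
    · rw [segment_same, mem_singleton_iff] at hp
      exact hp ▸ P.center_mem_drawing v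
    · exact P.segment_subset_drawing (P.adj_of_dist_le hne h) hp

theorem locallyFinite_segment : LocallyFinite fun x : P.ShortPair =>
    segment ℝ (P.center x.1.1) (P.center x.1.2) := by
  intro p
  refine ⟨ball p 1, ball_mem_nhds p one_pos, ?_⟩
  have hfin := P.finite_center_mem_closedBall p 2
  refine Set.Finite.subset ((hfin.prod hfin).preimage (f := fun x : P.ShortPair => x.1)
    Subtype.val_injective.injOn) ?_
  rintro ⟨⟨v, w⟩, h⟩ ⟨z, hz, hzp⟩
  have hzv : dist z (P.center v) ≤ 1 := by
    rw [dist_comm]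
    exact (mem_closedBall'.1 ((convex_closedBall (P.center v) 1).segment_subset
      (mem_closedBall_self zero_le_one) (mem_closedBall'.2 h) hz))
  have hzw : dist z (P.center w) ≤ 1 := by
    rw [dist_comm]
    exact (mem_closedBall'.1 ((convex_closedBall (P.center w) 1).segment_subset
      (mem_closedBall.2 h) (mem_closedBall_self zero_le_one) hz))
  rw [mem_ball] at hzp
  have hv : dist (P.center v) p ≤ 2 := by linarith [dist_triangle_left (P.center v) p z]
  have hw : dist (P.center w) p ≤ 2 := by linarith [dist_triangle_left (P.center w) p z]
  exact ⟨hv, hw⟩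

theorem isClosed_drawing : IsClosed P.drawing := by
  rw [drawing_eq_iUnion]
  refine P.locallyFinite_segment.isClosed_iUnion fun x => ?_
  rw [segment_eq_image_lineMap]
  exact (isCompact_Icc.image (by fun_prop)).isClosed

theorem dense_compl_drawing : Dense P.drawingᶜ := by
  refine Measure.dense_of_ae (μ := volume) (p := fun x => x ∉ P.drawing) ?_
  have hc : Countable P.ShortPair := by
    rw [← countable_univ_iff]
    exact P.locallyFinite_segment.countable_univ fun x => ⟨_, left_mem_segment ..⟩
  rw [← measure_eq_zero_iff_ae_notMem, drawing_eq_iUnion]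
  exact measure_iUnion_null fun x => Plane.volume_segment _ _

theorem isPreconnected_drawing (hconn : P.graph.Connected) : IsPreconnected P.drawing := by
  obtain ⟨x₀⟩ := hconn.nonempty
  have key : ∀ v w : V, P.graph.Walk v w →
      ∃ t ⊆ P.drawing, P.center v ∈ t ∧ P.center w ∈ t ∧ IsPreconnected t := by
    intro v w p
    induction p with
    | nil =>
      exact ⟨{P.center _}, singleton_subset_iff.2 (P.center_mem_drawing _), rfl, rfl,
        isPreconnected_singleton⟩
    | @cons u v w hadj p ih =>
      obtain ⟨t, ht, hv, hw, htc⟩ := ih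
      exact ⟨segment ℝ (P.center u) (P.center v) ∪ t,
        union_subset (P.segment_subset_drawing hadj) ht, Or.inl (left_mem_segment ..), Or.inr hw,
        IsPreconnected.union (P.center v) (right_mem_segment ..) hv
          (convex_segment _ _).isPreconnected htc⟩
  refine isPreconnected_of_forall (P.center x₀) ?_
  rintro y (⟨v, rfl⟩ | ⟨v, w, h, hy⟩)
  · exact key x₀ v (hconn.preconnected x₀ v).some
  · obtain ⟨t, ht, h₀, hv, htc⟩ := key x₀ v (hconn.preconnected x₀ v).some
    exact ⟨t ∪ segment ℝ (P.center v) (P.center w), union_subset ht (P.segment_subset_drawing h),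
      Or.inl h₀, Or.inr hy,
      IsPreconnected.union (P.center v) hv (left_mem_segment ..) htc
        (convex_segment _ _).isPreconnected⟩

/-- The parts of the drawing off an edge keep away from the interior points of that edge. -/
theorem min_le_two_mul_dist {v w : V} (hvw : P.graph.Adj v w) {t : ℝ} (ht₀ : 0 ≤ t) (ht₁ : t ≤ 1)
    {p : Plane} (hp : p ∈ P.drawing) (hp' : p ∉ segment ℝ (P.center v) (P.center w)) :
    min t (1 - t) ≤ 2 * dist p (P.center v + t • (P.center w - P.center v)) := by
  have hτ₀ : 0 ≤ min t (1 - t) := le_min ht₀ (by linarith)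
  have hsq : ∀ {a b : V}, a ≠ b → 1 ≤ dist (P.center a) (P.center b) ^ 2 := fun h =>
    one_le_pow₀ (P.one_le_dist h)
  have h1 : dist (P.center v) (P.center w) = 1 := hvw
  suffices h : min t (1 - t) ^ 2 ≤
      (2 * dist p (P.center v + t • (P.center w - P.center v))) ^ 2 from
    le_of_sq_le_sq h (by positivity)
  have hmt : min t (1 - t) ^ 2 ≤ t ^ 2 := pow_le_pow_left₀ hτ₀ (min_le_left _ _) 2
  have hmt' : min t (1 - t) ^ 2 ≤ (1 - t) ^ 2 := pow_le_pow_left₀ hτ₀ (min_le_right _ _) 2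
  rw [mul_pow]
  rw [drawing_eq_iUnion, mem_iUnion] at hp
  obtain ⟨⟨⟨a, b⟩, hab⟩, hp⟩ := hp
  simp only at hab hp
  have hpseg := hp
  rw [segment_eq_image'] at hp
  obtain ⟨s, ⟨hs₀, hs₁⟩, rfl⟩ := hp
  have hab1 : dist (P.center a) (P.center b) ^ 2 ≤ 1 := pow_le_one₀ dist_nonneg hab
  rw [Plane.dist_sq_lineMap, h1]
  have hs₁' : 0 ≤ 1 - s := by linarith
  have ht₁' : 0 ≤ 1 - t := by linarith
  have k₁ := mul_nonneg hs₁' ht₁'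
  have k₂ := mul_nonneg hs₁' ht₀
  have k₃ := mul_nonneg hs₀ ht₁'
  have k₄ := mul_nonneg hs₀ ht₀
  have k₅ := mul_le_mul_of_nonneg_left hab1 (mul_nonneg hs₀ hs₁')
  -- With no common endpoint all four distances are at least `1`. With a common endpoint, say `a =
  -- v`, the squared distance is at least `s ^ 2 - s * t + t ^ 2 = (s - t / 2) ^ 2 + 3 / 4 * t ^ 2`,
  -- the case of two edges at an angle of 60 degrees.
  by_cases hav : a = v
  · subst hav
    have hbw : b ≠ w := by rintro rfl; exact hp' hpseg
    have e₄ := mul_le_mul_of_nonneg_left (hsq hbw) k₄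
    rcases eq_or_ne b a with rfl | hba
    · exact absurd (by rw [segment_same] at hpseg; rw [hpseg]; exact left_mem_segment ..) hp'
    have e₃ := mul_le_mul_of_nonneg_left (hsq hba) k₃
    rw [dist_self, h1]
    nlinarith [sq_nonneg (s - t / 2), sq_nonneg t]
  by_cases haw : a = w
  · subst haw
    have hbv : b ≠ v := by rintro rfl; exact hp' (by rwa [segment_symm])
    have e₃ := mul_le_mul_of_nonneg_left (hsq hbv) k₃
    rcases eq_or_ne b a with rfl | hba
    · exact absurd (by rw [segment_same] at hpseg; rw [hpseg]; exact right_mem_segment ..) hp'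
    have e₄ := mul_le_mul_of_nonneg_left (hsq hba) k₄
    rw [dist_self, dist_comm (P.center a), h1]
    nlinarith [sq_nonneg (s - (1 - t) / 2), sq_nonneg (1 - t)]
  have e₁ := mul_le_mul_of_nonneg_left (hsq hav) k₁
  have e₂ := mul_le_mul_of_nonneg_left (hsq haw) k₂
  by_cases hbv : b = v
  · subst hbv
    have e₄ := mul_le_mul_of_nonneg_left (hsq hvw.ne) k₄
    rw [dist_self]
    nlinarith [sq_nonneg (1 - s - t / 2), sq_nonneg t]
  have e₃ := mul_le_mul_of_nonneg_left (hsq hbv) k₃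
  by_cases hbw : b = w
  · subst hbw
    rw [dist_self]
    nlinarith [sq_nonneg (1 - s - (1 - t) / 2), sq_nonneg (1 - t)]
  have e₄ := mul_le_mul_of_nonneg_left (hsq hbw) k₄
  nlinarith [sq_nonneg (s - 1 / 2)]

/-! ### Faces and the pennies they touch -/

/-- The face containing a point off the drawing. -/
def faceAt (p : Plane) : Set Plane := connectedComponentIn P.drawingᶜ p

/-- The vertices whose penny meets a set. -/
def touching (σ : Set Plane) : Set V := {v | (σ ∩ P.penny v).Nonempty}

theorem isOpen_faceAt (p : Plane) : IsOpen (P.faceAt p) :=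
  P.isClosed_drawing.isOpen_compl.connectedComponentIn

theorem mem_faceAt {p : Plane} (hp : p ∉ P.drawing) : p ∈ P.faceAt p :=
  mem_connectedComponentIn hp

theorem faceAt_subset (p : Plane) : P.faceAt p ⊆ P.drawingᶜ := connectedComponentIn_subset _ _

theorem faceAt_eq {p q : Plane} (h : q ∈ P.faceAt p) : P.faceAt q = P.faceAt p :=
  (connectedComponentIn_eq h).symm

theorem isPreconnected_faceAt (p : Plane) : IsPreconnected (P.faceAt p) :=
  isPreconnected_connectedComponentIn

theorem frontier_faceAt_subset (p : Plane) : frontier (P.faceAt p) ⊆ P.drawing := by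
  intro q hq
  by_contra hqd
  rw [(P.isOpen_faceAt p).frontier_eq] at hq
  obtain ⟨z, hz₁, hz₂⟩ := mem_closure_iff.1 hq.1 _ (P.isOpen_faceAt q) (P.mem_faceAt hqd)
  refine hq.2 ?_
  rw [← P.faceAt_eq hz₂, P.faceAt_eq hz₁]
  exact P.mem_faceAt hqd

/-- A point close to the edge can slide parallel to it into the penny of `v` without crossing the
drawing. -/
theorem exists_ball_of_mem_openSegment {v w : V} (hvw : P.graph.Adj v w) {q : Plane}
    (hq : q ∈ openSegment ℝ (P.center v) (P.center w)) :
    ∃ r > 0, ∀ z ∈ ball q r, z ∉ P.drawing → v ∈ P.touching (P.faceAt z) := by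
  rw [openSegment_eq_image'] at hq
  obtain ⟨t, ⟨ht₀, ht₁⟩, rfl⟩ := hq
  set d : Plane := P.center w - P.center v with hd
  have hd1 : ‖d‖ = 1 := by rw [hd, ← dist_eq_norm, dist_comm]; exact hvw
  -- The slide stops at parameter `m`, at distance less than `m + m / 2 ≤ 3 / 8` from the center of
  -- `v`. The offset `y` is shorter than `m / 2`, so `min_le_two_mul_dist` keeps the path off the
  -- rest of the drawing.
  set m : ℝ := min (min t (1 - t)) (1 / 4) with hm
  have hmt : m ≤ t := (min_le_left _ _).trans (min_le_left _ _)
  have hmt' : m ≤ 1 - t := (min_le_left _ _).trans (min_le_right _ _)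
  have hm4 : m ≤ 1 / 4 := min_le_right _ _
  have hmpos : 0 < m := lt_min (lt_min ht₀ (by linarith)) (by norm_num)
  refine ⟨m / 2, by positivity, fun z hz hzd => ?_⟩
  simp only at hz
  set y : Plane := z - (P.center v + t • d) with hy
  have hyz : z = P.center v + t • d + y := by rw [hy]; abel
  have hyn : ‖y‖ < m / 2 := by rw [hy, ← dist_eq_norm]; exact hz
  have hpath : (fun u : ℝ => P.center v + u • d + y) '' Icc m t ⊆ P.drawingᶜ := by
    rintro _ ⟨u, ⟨hu₁, hu₂⟩, rfl⟩ hud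
    -- Hitting the edge itself forces `y` to be parallel to it, which would put `z` on the edge.
    by_cases hseg : P.center v + u • d + y ∈ segment ℝ (P.center v) (P.center w)
    · rw [segment_eq_image'] at hseg
      obtain ⟨s, -, hs⟩ := hseg
      have hys : y = (s - u) • d := by
        have h₂ : P.center v + s • d = P.center v + u • d + y := hs
        rw [sub_smul, sub_eq_iff_eq_add.2]
        have := add_left_cancel (h₂.trans (add_assoc _ _ _))
        rw [this, add_comm]
      have habs : |s - u| < m / 2 := by
        have : ‖y‖ = |s - u| := by rw [hys, norm_smul, hd1, mul_one, Real.norm_eq_abs]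
        rwa [← this]
      rw [abs_lt] at habs
      refine hzd (P.segment_subset_drawing hvw ?_)
      rw [segment_eq_image']
      refine ⟨t + (s - u), ⟨by linarith, by linarith⟩, ?_⟩
      change P.center v + (t + (s - u)) • d = z
      rw [hyz, add_smul, ← hys, add_assoc]
    · have h₂ := P.min_le_two_mul_dist hvw (t := u) (by linarith) (by linarith) hud hseg
      rw [← hd, dist_eq_norm, add_sub_cancel_left] at h₂
      have : m ≤ min u (1 - u) := le_min hu₁ (by linarith)
      linarith
  have hsub := (isPreconnected_Icc.image _ (by fun_prop)).subset_connectedComponentIn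
    ⟨t, ⟨hmt, le_rfl⟩, hyz.symm⟩ hpath
  refine ⟨_, hsub ⟨m, ⟨le_rfl, hmt⟩, rfl⟩, ?_⟩
  change dist (P.center v + m • d + y) (P.center v) < 1 / 2
  rw [dist_eq_norm, add_assoc, add_sub_cancel_left]
  calc _ ≤ ‖m • d‖ + ‖y‖ := norm_add_le _ _
    _ = m + ‖y‖ := by rw [norm_smul, hd1, mul_one, Real.norm_of_nonneg hmpos.le]
    _ < 1 / 2 := by linarith

/-- Every point of the drawing has a neighbourhood in which all faces meet the penny of one
nearby vertex. -/
theorem exists_ball_of_mem_drawing {q : Plane} (hq : q ∈ P.drawing) :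
    ∃ v, dist q (P.center v) ≤ 1 / 2 ∧
      ∃ r > 0, ∀ z ∈ ball q r, z ∉ P.drawing → v ∈ P.touching (P.faceAt z) := by
  have hcenter : ∀ v, q = P.center v → dist q (P.center v) ≤ 1 / 2 ∧
      ∃ r > 0, ∀ z ∈ ball q r, z ∉ P.drawing → v ∈ P.touching (P.faceAt z) := by
    rintro v rfl
    exact ⟨by simp, 1 / 2, by norm_num, fun z hz hzd => ⟨z, P.mem_faceAt hzd, hz⟩⟩
  rcases hq with ⟨v, rfl⟩ | ⟨v, w, hvw, hq⟩
  · exact ⟨v, hcenter v rfl⟩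
  by_cases hqv : q = P.center v
  · exact ⟨v, hcenter v hqv⟩
  by_cases hqw : q = P.center w
  · exact ⟨w, hcenter w hqw⟩
  have hopen : q ∈ openSegment ℝ (P.center v) (P.center w) :=
    mem_openSegment_of_ne_left_right (Ne.symm hqv) (Ne.symm hqw) hq
  have hsum := dist_add_dist_of_mem_segment hq
  rw [P.adj_iff_dist.1 hvw, dist_comm] at hsum
  rcases le_total (dist q (P.center v)) (1 / 2) with h | h
  · exact ⟨v, h, P.exists_ball_of_mem_openSegment hvw hopen⟩
  · exact ⟨w, by linarith,
      P.exists_ball_of_mem_openSegment hvw.symm (by rwa [openSegment_symm])⟩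

theorem exists_touching_of_mem_frontier {p q : Plane} (hq : q ∈ frontier (P.faceAt p)) :
    ∃ v ∈ P.touching (P.faceAt p), dist q (P.center v) ≤ 1 / 2 := by
  obtain ⟨v, hv, r, hr, h⟩ := P.exists_ball_of_mem_drawing (P.frontier_faceAt_subset p hq)
  obtain ⟨z, hz₁, hz₂⟩ := mem_closure_iff.1 (frontier_subset_closure hq) _ isOpen_ball
    (mem_ball_self hr)
  refine ⟨v, ?_, hv⟩
  rw [← P.faceAt_eq hz₂]
  exact h z hz₁ (P.faceAt_subset p hz₂)

theorem faceAt_mem_faces {p : Plane} (hp : p ∉ P.drawing) : P.faceAt p ∈ P.faces := ⟨p, hp, rfl⟩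

/-- Choose one corner in each touched penny; disjointness of the pennies makes this choice
injective. -/
theorem encard_touching_le (σ : Set Plane) : (P.touching σ).encard ≤ P.facialDegree σ := by
  have h : ∀ v : V, ∃ p, v ∈ P.touching σ → p ∈ σ ∩ P.penny v := by
    intro v
    by_cases hv : v ∈ P.touching σ
    · exact ⟨hv.some, fun _ => hv.some_mem⟩
    · exact ⟨0, fun h => absurd h hv⟩
  choose f hf using h
  refine Set.encard_le_encard_of_injOn
    (f := fun v => connectedComponentIn (σ ∩ P.penny v) (f v)) ?_ ?_
  · intro v hv
    exact ⟨v, f v, hf v hv, rfl⟩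
  · intro v hv w hw hvw
    by_contra hne
    have h₁ : f v ∈ connectedComponentIn (σ ∩ P.penny w) (f w) := by
      simp only at hvw
      rw [← hvw]
      exact mem_connectedComponentIn (hf v hv)
    exact Set.disjoint_left.1 (P.pairwise_disjoint hne) (hf v hv).2
      (connectedComponentIn_subset _ _ h₁).2

end PennyConfiguration

/-! ### The boundary of a face: graph distance and size -/

namespace PennyConfiguration

variable {V : Type*} (P : PennyConfiguration V)

theorem faceAt_ne_univ [Nonempty V] (p : Plane) : P.faceAt p ≠ univ := by
  intro h
  obtain ⟨v⟩ := ‹Nonempty V›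
  exact P.faceAt_subset p (h ▸ mem_univ (P.center v)) (P.center_mem_drawing v)

theorem frontier_faceAt_nonempty [Nonempty V] {p : Plane} (hp : p ∉ P.drawing) :
    (frontier (P.faceAt p)).Nonempty :=
  nonempty_frontier_iff.2 ⟨⟨p, P.mem_faceAt hp⟩, P.faceAt_ne_univ p⟩

theorem touching_faceAt_nonempty [Nonempty V] {p : Plane} (hp : p ∉ P.drawing) :
    (P.touching (P.faceAt p)).Nonempty := by
  obtain ⟨q, hq⟩ := P.frontier_faceAt_nonempty hp
  obtain ⟨v, hv, -⟩ := P.exists_touching_of_mem_frontier hq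
  exact ⟨v, hv⟩

theorem exists_mem_frontier_of_mem_touching {p : Plane} {v : V}
    (hv : v ∈ P.touching (P.faceAt p)) : (P.penny v ∩ frontier (P.faceAt p)).Nonempty := by
  obtain ⟨x, hx, hxv⟩ := hv
  exact (convex_ball _ _).isPreconnected.exists_mem_frontier ⟨x, hxv, hx⟩
    ⟨P.center v, mem_ball_self (by norm_num),
      fun h => P.faceAt_subset p h (P.center_mem_drawing v)⟩

/-- The complement of a face of a connected penny graph is connected. -/
theorem isPreconnected_compl_faceAt (hconn : P.graph.Connected) (p : Plane) :
    IsPreconnected (P.faceAt p)ᶜ := by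
  have := hconn.nonempty
  obtain ⟨x₀⟩ := hconn.nonempty
  have hD : P.drawing ⊆ (P.faceAt p)ᶜ := fun y hy h => P.faceAt_subset p h hy
  refine isPreconnected_of_forall (P.center x₀) fun y hy => ?_
  by_cases hyd : y ∈ P.drawing
  · exact ⟨P.drawing, hD, P.center_mem_drawing x₀, hyd, P.isPreconnected_drawing hconn⟩
  obtain ⟨z, hz⟩ := P.frontier_faceAt_nonempty hyd
  refine ⟨closure (P.faceAt y) ∪ P.drawing, union_subset ?_ hD,
    Or.inr (P.center_mem_drawing x₀), Or.inl (subset_closure (P.mem_faceAt hyd)),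
    IsPreconnected.union z (frontier_subset_closure hz) (P.frontier_faceAt_subset y hz)
      (P.isPreconnected_faceAt y).closure (P.isPreconnected_drawing hconn)⟩
  rw [closure_eq_self_union_frontier]
  refine union_subset (fun z hz hzp => hy ?_) ((P.frontier_faceAt_subset y).trans hD)
  rw [← P.faceAt_eq hzp, P.faceAt_eq hz]
  exact P.mem_faceAt hyd

/-- In a connected penny graph, any two vertices on the boundary of a face are joined by a path
whose length is at most the number of vertices on the boundary. -/
theorem graph_dist_le_of_touching (hconn : P.graph.Connected) {p : Plane}
    (hfin : (P.touching (P.faceAt p)).Finite) {v w : V} (hv : v ∈ P.touching (P.faceAt p))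
    (hw : w ∈ P.touching (P.faceAt p)) :
    P.graph.dist v w ≤ (P.touching (P.faceAt p)).ncard := by
  set σ := P.faceAt p with hσ
  have : Finite (P.touching σ) := hfin
  -- Only finitely many pairs are involved, so some `ε` makes overlap of the disks of radius `1 / 2
  -- + ε` imply equality or tangency.
  obtain ⟨ε, hgap, hε⟩ : ∃ ε : ℝ, (∀ i j : P.touching σ,
      dist (P.center i) (P.center j) < 1 + 2 * ε → dist (P.center i) (P.center j) ≤ 1) ∧ 0 < ε := by
    have h : ∀ᶠ ε : ℝ in 𝓝[>] 0, ∀ i j : P.touching σ,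
        dist (P.center i) (P.center j) < 1 + 2 * ε → dist (P.center i) (P.center j) ≤ 1 := by
      refine Filter.eventually_all.2 fun i => Filter.eventually_all.2 fun j => ?_
      by_cases hij : dist (P.center i) (P.center j) ≤ 1
      · exact Filter.Eventually.of_forall fun _ _ => hij
      · push Not at hij
        filter_upwards [Ioo_mem_nhdsGT (half_pos (sub_pos.2 hij))] with ε hε h
        linarith [hε.2]
    exact (h.and self_mem_nhdsWithin).exists
  have hnear : ∀ x q : Plane, q ∈ frontier σ → dist x q < ε →
      x ∈ ⋃ i : P.touching σ, ball (P.center i) (1 / 2 + ε) := by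
    intro x q hq hxq
    obtain ⟨u, hu, huq⟩ := P.exists_touching_of_mem_frontier hq
    refine mem_iUnion.2 ⟨⟨u, hu⟩, ?_⟩
    rw [mem_ball]
    linarith [dist_triangle x q (P.center u)]
  have hcross : ∀ x y : Plane, x ∈ σ → y ∈ σᶜ → dist x y < ε →
      ∃ q ∈ frontier σ, dist x q < ε ∧ dist y q < ε := by
    intro x y hx hy hxy
    obtain ⟨q, hq, hqf⟩ := (convex_segment x y).isPreconnected.exists_mem_frontier
      ⟨x, left_mem_segment .., hx⟩ ⟨y, right_mem_segment .., hy⟩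
    have := dist_add_dist_of_mem_segment hq
    refine ⟨q, hqf, ?_, ?_⟩
    · linarith [dist_nonneg (x := q) (y := y)]
    · rw [dist_comm]; linarith [dist_nonneg (x := x) (y := q)]
  -- Unicoherence needs open sets, hence thickenings in place of the face and its complement.
  have hpre : IsPreconnected (thickening ε σ ∩ thickening ε σᶜ) := by
    refine IsPreconnected.inter_of_union_eq_univ isOpen_thickening isOpen_thickening
      ((P.isPreconnected_faceAt p).thickening hε)
      ((P.isPreconnected_compl_faceAt hconn p).thickening hε) (eq_univ_of_forall fun x => ?_)
    by_cases hx : x ∈ σ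
    · exact Or.inl (self_subset_thickening hε _ hx)
    · exact Or.inr (self_subset_thickening hε _ hx)
  have hcard : Nat.card (P.touching σ) = (P.touching σ).ncard := rfl
  rw [← hcard, ← one_mul (Nat.card _)]
  refine hconn.dist_le_of_cover hpre (O := fun i : P.touching σ => ball (P.center i) (1 / 2 + ε))
    (f := fun i => (i : V)) (fun i => isOpen_ball) ?_ ?_ ?_ ⟨v, hv⟩ ⟨w, hw⟩
  · rintro x ⟨hx₁, hx₂⟩
    obtain ⟨y₁, hy₁, hxy₁⟩ := mem_thickening_iff.1 hx₁
    obtain ⟨y₂, hy₂, hxy₂⟩ := mem_thickening_iff.1 hx₂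
    by_cases hx : x ∈ σ
    · obtain ⟨q, hq, hxq, -⟩ := hcross x y₂ hx hy₂ hxy₂
      exact hnear x q hq hxq
    · obtain ⟨q, hq, -, hxq⟩ := hcross y₁ x hy₁ hx (by rwa [dist_comm])
      exact hnear x q hq hxq
  · rintro ⟨u, hu⟩
    obtain ⟨z, hzu, hz⟩ := P.exists_mem_frontier_of_mem_touching hu
    have hz' : z ∈ frontier σᶜ := by rwa [frontier_compl]
    exact ⟨z, ⟨closure_subset_thickening hε _ (frontier_subset_closure hz),
      closure_subset_thickening hε _ (frontier_subset_closure hz')⟩,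
      ball_subset_ball (by linarith) hzu⟩
  · rintro i j ⟨x, hxi, hxj⟩
    refine P.graph_dist_le_one (hgap i j ?_)
    rw [mem_ball] at hxi hxj
    linarith [dist_triangle_left (P.center i) (P.center j) x]

/-- A face of an infinite connected penny graph with finitely many boundary vertices is bounded. -/
theorem faceAt_subset_closedBall [Infinite V] (hconn : P.graph.Connected) {p : Plane}
    (hfin : (P.touching (P.faceAt p)).Finite) {v : V} (hv : v ∈ P.touching (P.faceAt p)) :
    P.faceAt p ⊆ closedBall (P.center v) ((P.touching (P.faceAt p)).ncard + 1 / 2) := by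
  set r : ℝ := (P.touching (P.faceAt p)).ncard + 1 / 2 with hr
  intro x hx
  by_contra hxr
  have hfr : ∀ q ∈ frontier (P.faceAt p), q ∈ closedBall (P.center v) r := by
    intro q hq
    obtain ⟨u, hu, huq⟩ := P.exists_touching_of_mem_frontier hq
    have h₁ := P.dist_center_le_graph_dist hconn u v
    have h₂ : (P.graph.dist u v : ℝ) ≤ (P.touching (P.faceAt p)).ncard := by
      exact_mod_cast P.graph_dist_le_of_touching hconn hfin hu hv
    rw [mem_closedBall]
    linarith [dist_triangle q (P.center u) (P.center v)]
  -- The frontier lies in the disk, so a face that leaves the disk contains its whole connected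
  -- exterior. All centers are then in the disk, which contradicts infinitude.
  have hsub : (closedBall (P.center v) r)ᶜ ⊆ P.faceAt p := by
    intro y hy
    by_contra hyσ
    obtain ⟨q, hq, hqf⟩ := (Plane.isPreconnected_compl_closedBall (P.center v)
      (r := r) (by positivity)).exists_mem_frontier ⟨x, hxr, hx⟩ ⟨y, hy, hyσ⟩
    exact hq (hfr q hqf)
  refine Set.infinite_univ (α := V) ((P.finite_center_mem_closedBall (P.center v) r).subset ?_)
  intro u _
  by_contra hu
  exact P.faceAt_subset p (hsub hu) (P.center_mem_drawing u)

/-! ### Regions, and graph distance against Euclidean distance -/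

/-- The open set of points near which every face meets the penny of `v`. -/
def region (v : V) : Set Plane := interior {p | p ∉ P.drawing → v ∈ P.touching (P.faceAt p)}

theorem isOpen_region (v : V) : IsOpen (P.region v) := isOpen_interior

theorem mem_touching_of_mem_region {v : V} {p : Plane} (h : p ∈ P.region v)
    (hp : p ∉ P.drawing) : v ∈ P.touching (P.faceAt p) :=
  interior_subset h hp

theorem mem_region_of_ball {v : V} {p : Plane} {r : ℝ} (hr : 0 < r)
    (h : ∀ z ∈ ball p r, z ∉ P.drawing → v ∈ P.touching (P.faceAt z)) : p ∈ P.region v :=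
  mem_interior.2 ⟨ball p r, h, isOpen_ball, mem_ball_self hr⟩

theorem center_mem_region (v : V) : P.center v ∈ P.region v :=
  P.mem_region_of_ball (r := 1 / 2) (by norm_num) fun z hz hzd => ⟨z, P.mem_faceAt hzd, hz⟩

theorem exists_mem_region [Nonempty V] (p : Plane) : ∃ v, p ∈ P.region v := by
  by_cases hp : p ∈ P.drawing
  · obtain ⟨v, -, r, hr, h⟩ := P.exists_ball_of_mem_drawing hp
    exact ⟨v, P.mem_region_of_ball hr h⟩
  · obtain ⟨v, hv⟩ := P.touching_faceAt_nonempty hp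
    refine ⟨v, mem_interior.2 ⟨P.faceAt p, fun z hz _ => ?_, P.isOpen_faceAt p, P.mem_faceAt hp⟩⟩
    rwa [P.faceAt_eq hz]

theorem exists_notMem_drawing {s : Set Plane} (hs : IsOpen s) (hne : s.Nonempty) :
    ∃ z ∈ s, z ∉ P.drawing := by
  obtain ⟨z, hz, hzd⟩ := P.dense_compl_drawing.inter_open_nonempty s hs hne
  exact ⟨z, hz, hzd⟩

variable {P} {D : ℕ}

theorem touching_faceAt_finite_ncard_le (hD : ∀ σ ∈ P.faces, P.facialDegree σ ≤ (D : ℕ∞))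
    {p : Plane} (hp : p ∉ P.drawing) :
    (P.touching (P.faceAt p)).Finite ∧ (P.touching (P.faceAt p)).ncard ≤ D :=
  Set.encard_le_coe_iff_finite_ncard_le.1
    ((P.encard_touching_le _).trans (hD _ (P.faceAt_mem_faces hp)))

/-- The overlap is open, so it contains a point off the drawing, whose face touches both pennies. -/
theorem graph_dist_le_of_region_inter (hconn : P.graph.Connected)
    (hD : ∀ σ ∈ P.faces, P.facialDegree σ ≤ (D : ℕ∞)) {v w : V}
    (h : (P.region v ∩ P.region w).Nonempty) : P.graph.dist v w ≤ D := by
  obtain ⟨z, ⟨hzv, hzw⟩, hzd⟩ :=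
    P.exists_notMem_drawing ((P.isOpen_region v).inter (P.isOpen_region w)) h
  obtain ⟨hfin, hcard⟩ := touching_faceAt_finite_ncard_le hD hzd
  exact (P.graph_dist_le_of_touching hconn hfin (P.mem_touching_of_mem_region hzv hzd)
    (P.mem_touching_of_mem_region hzw hzd)).trans hcard

theorem dist_center_le_of_mem_region [Infinite V] (hconn : P.graph.Connected)
    (hD : ∀ σ ∈ P.faces, P.facialDegree σ ≤ (D : ℕ∞)) {v : V} {p : Plane}
    (h : p ∈ P.region v) : dist p (P.center v) ≤ D + 1 := by
  obtain ⟨z, ⟨hzv, hzp⟩, hzd⟩ := P.exists_notMem_drawing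
    ((P.isOpen_region v).inter (isOpen_ball (x := p) (ε := 1 / 2)))
    ⟨p, h, mem_ball_self (by norm_num)⟩
  obtain ⟨hfin, hcard⟩ := touching_faceAt_finite_ncard_le hD hzd
  have h₁ := P.faceAt_subset_closedBall hconn hfin (P.mem_touching_of_mem_region hzv hzd)
    (P.mem_faceAt hzd)
  have hcard' : ((P.touching (P.faceAt z)).ncard : ℝ) ≤ D := by exact_mod_cast hcard
  rw [mem_closedBall] at h₁
  rw [mem_ball, dist_comm] at hzp
  linarith [dist_triangle p z (P.center v)]

/-- Vertices whose regions meet a common unit segment are at bounded combinatorial distance. -/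
theorem graph_dist_le_of_dist_le_one [Infinite V] (hconn : P.graph.Connected)
    (hD : ∀ σ ∈ P.faces, P.facialDegree σ ≤ (D : ℕ∞)) {v w : V} {p q : Plane}
    (hpq : dist p q ≤ 1) (hp : p ∈ P.region v) (hq : q ∈ P.region w) :
    P.graph.dist v w ≤ D * (2 * D + 5) ^ 2 := by
  set N : Set V := {u | (segment ℝ p q ∩ P.region u).Nonempty} with hN
  have hsub : N ⊆ {u | P.center u ∈ closedBall p (D + 2)} := by
    rintro u ⟨x, hx, hxu⟩
    have h₁ := dist_center_le_of_mem_region hconn hD hxu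
    have h₂ := dist_add_dist_of_mem_segment hx
    have h₃ : dist (P.center u) p ≤ D + 2 := by
      rw [dist_comm]
      linarith [dist_triangle p x (P.center u), dist_nonneg (x := x) (y := q)]
    exact h₃
  have hfin := P.finite_center_mem_closedBall p (D + 2)
  have : Finite N := hfin.subset hsub
  -- The centers lie within `1 + (D + 1)` of `p`, and `2 * (D + 2) + 1 = 2 * D + 5`.
  have hcard : Nat.card N ≤ (2 * D + 5) ^ 2 := by
    have h₁ : (N.ncard : ℝ) ≤ (2 * (D + 2 : ℝ) + 1) ^ 2 :=
      (Nat.cast_le.2 (Set.ncard_le_ncard hsub hfin)).trans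
        (P.ncard_center_mem_closedBall_le p (by positivity))
    have h₂ : (N.ncard : ℝ) ≤ (((2 * D + 5) ^ 2 : ℕ) : ℝ) := by
      push_cast
      linarith
    exact_mod_cast h₂
  refine le_trans ?_ (Nat.mul_le_mul_left D hcard)
  refine hconn.dist_le_of_cover (convex_segment p q).isPreconnected
    (O := fun u : N => P.region u) (f := fun u => (u : V)) (fun u => P.isOpen_region u) ?_
    (fun u => u.2) (fun u u' h => graph_dist_le_of_region_inter hconn hD h)
    ⟨v, p, left_mem_segment .., hp⟩ ⟨w, q, right_mem_segment .., hq⟩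
  intro x hx
  obtain ⟨u, hu⟩ := P.exists_mem_region x
  exact mem_iUnion.2 ⟨⟨u, x, hx, hu⟩, hu⟩

/-- The segment is cut into steps of length at most one; the extra `1` in `n + 1` pays for passing
from `x` to another vertex whose region contains the same point. -/
theorem graph_dist_le_of_dist_le [Infinite V] (hconn : P.graph.Connected)
    (hD : ∀ σ ∈ P.faces, P.facialDegree σ ≤ (D : ℕ∞)) (x : V) (n : ℕ) {v : V} {p : Plane}
    (hpx : dist (P.center x) p ≤ n) (hp : p ∈ P.region v) :
    P.graph.dist x v ≤ (n + 1) * (D * (2 * D + 5) ^ 2) := by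
  induction n generalizing v p with
  | zero =>
    rw [zero_add, one_mul]
    refine graph_dist_le_of_dist_le_one hconn hD (hpx.trans ?_) (P.center_mem_region x) hp
    simp
  | succ n ih =>
    have hn : (0 : ℝ) < n + 1 := by positivity
    push_cast at hpx
    have hpos : (0 : ℝ) ≤ n / (n + 1) := by positivity
    obtain ⟨u, hu⟩ := P.exists_mem_region (AffineMap.lineMap (P.center x) p ((n : ℝ) / (n + 1)))
    have h₁ := ih (v := u) (p := AffineMap.lineMap (P.center x) p ((n : ℝ) / (n + 1))) (by
      rw [dist_left_lineMap, Real.norm_of_nonneg hpos, div_mul_eq_mul_div, div_le_iff₀ hn]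
      exact mul_le_mul_of_nonneg_left hpx (Nat.cast_nonneg n)) hu
    have h₂ := graph_dist_le_of_dist_le_one hconn hD (by
      rw [dist_lineMap_right, show (1 : ℝ) - n / (n + 1) = 1 / (n + 1) by field_simp; ring,
        Real.norm_of_nonneg (by positivity), div_mul_eq_mul_div, div_le_iff₀ hn]
      linarith) hu hp
    calc _ ≤ _ := hconn.dist_triangle
      _ ≤ _ := add_le_add h₁ h₂
      _ = _ := by ring

/-! ### Volume bounds -/

theorem combBall_finite (hconn : P.graph.Connected) (x : V) (R : ℝ) :
    (P.graph.combBall x R).Finite :=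
  (P.finite_center_mem_closedBall (P.center x) R).subset fun y hy =>
    (P.dist_center_le_graph_dist hconn y x).trans hy

theorem vol_le (hconn : P.graph.Connected) (x : V) {R : ℝ} (hR : 0 ≤ R) :
    P.graph.vol x R ≤ (2 * R + 1) ^ 2 :=
  (Nat.cast_le.2 (Set.ncard_le_ncard
    (fun y hy => (P.dist_center_le_graph_dist hconn y x).trans hy)
    (P.finite_center_mem_closedBall (P.center x) R))).trans
    (P.ncard_center_mem_closedBall_le (P.center x) hR)

theorem one_le_vol (hconn : P.graph.Connected) (x : V) {R : ℝ} (hR : 0 ≤ R) :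
    1 ≤ P.graph.vol x R := by
  have h : x ∈ P.graph.combBall x R := by simpa [SimpleGraph.combBall] using hR
  have := (Set.ncard_pos (combBall_finite hconn x R)).2 ⟨x, h⟩
  rw [SimpleGraph.vol]
  exact_mod_cast this

theorem vol_mono (hconn : P.graph.Connected) (x : V) {r R : ℝ} (h : r ≤ R) :
    P.graph.vol x r ≤ P.graph.vol x R :=
  Nat.cast_le.2 (Set.ncard_le_ncard (fun _ hy => le_trans hy h) (combBall_finite hconn x R))

/-- Every point of the Euclidean disk of radius `n` lies in some region; its vertex is in the
combinatorial ball and within `D + 1` of the point. Areas are then compared. -/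
theorem sq_le_vol_mul [Infinite V] (hconn : P.graph.Connected)
    (hD : ∀ σ ∈ P.faces, P.facialDegree σ ≤ (D : ℕ∞)) (x : V) (n : ℕ) {R : ℝ}
    (hR : (n + 1) * (D * (2 * D + 5) ^ 2) ≤ R) :
    (n : ℝ) ^ 2 ≤ P.graph.vol x R * (D + 1) ^ 2 := by
  refine P.sq_le_ncard_mul_sq (p := P.center x) (Nat.cast_nonneg n) (by positivity)
    (combBall_finite hconn x R) fun p hp => ?_
  obtain ⟨v, hv⟩ := P.exists_mem_region p
  refine mem_biUnion (x := v) ?_ (dist_center_le_of_mem_region hconn hD hv)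
  have h := graph_dist_le_of_dist_le hconn hD x n (mem_ball'.1 hp).le hv
  rw [SimpleGraph.dist_comm] at h
  have h' : (P.graph.dist v x : ℝ) ≤ (n + 1) * (D * (2 * D + 5) ^ 2) := by exact_mod_cast h
  exact h'.trans hR

/-- Quadratic lower volume bound. -/
theorem mul_sq_le_vol [Infinite V] (hconn : P.graph.Connected)
    (hD : ∀ σ ∈ P.faces, P.facialDegree σ ≤ (D : ℕ∞)) (x : V) {R : ℝ} (hR : 1 ≤ R) {K : ℝ}
    (hK : K = D * (2 * D + 5) ^ 2 + 1) :
    1 / (16 * K ^ 2 * (D + 1) ^ 2) * R ^ 2 ≤ P.graph.vol x R := by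
  have hK1 : 1 ≤ K := by rw [hK]; linarith [show (0 : ℝ) ≤ D * (2 * D + 5) ^ 2 by positivity]
  have hDpos : (1 : ℝ) ≤ (D + 1) ^ 2 := one_le_pow₀ (by linarith [Nat.cast_nonneg (α := ℝ) D])
  rw [one_div_mul_eq_div, div_le_iff₀ (by positivity)]
  have hvol := one_le_vol hconn x (zero_le_one.trans hR)
  -- For `R ≤ 4 * K` the bound `1 ≤ vol` suffices. The `+ 1` in `K` keeps it at least `1`, also when
  -- `D = 0`.
  rcases le_total R (4 * K) with h | h
  · have h₁ : R ^ 2 ≤ 16 * K ^ 2 := by nlinarith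
    have h₂ : 1 ≤ P.graph.vol x R * (D + 1) ^ 2 := one_le_mul_of_one_le_of_one_le hvol hDpos
    nlinarith [mul_le_mul_of_nonneg_left h₂ (show 0 ≤ 16 * K ^ 2 by positivity)]
  -- This `n` satisfies `(n + 1) * K ≤ R`, and `R / K < n + 2` with `R / K ≥ 4` gives `R ≤ 4 * K *
  -- n`.
  · set n : ℕ := ⌊R / K⌋₊ - 1 with hn
    have hdiv : 4 ≤ R / K := by rw [le_div_iff₀ (by linarith)]; exact h
    have hfl : 1 ≤ ⌊R / K⌋₊ := Nat.le_floor (by norm_num; linarith)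
    have hn' : (n : ℝ) + 1 = ⌊R / K⌋₊ := by
      rw [hn, Nat.cast_sub hfl]; push_cast; ring
    have h₁ : (n : ℝ) + 1 ≤ R / K := hn' ▸ Nat.floor_le (by positivity)
    have h₂ : R / K < n + 1 + 1 := hn' ▸ Nat.lt_floor_add_one _
    have h₃ := sq_le_vol_mul hconn hD x n (R := R) (by
      rw [le_div_iff₀ (by linarith)] at h₁
      refine le_trans (mul_le_mul_of_nonneg_left ?_ (by positivity)) h₁
      linarith)
    have h₄ : R ≤ 4 * K * n := by
      have : R / K ≤ 4 * n := by linarith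
      rw [div_le_iff₀ (by linarith)] at this
      linarith
    calc R ^ 2 ≤ (4 * K * n) ^ 2 := pow_le_pow_left₀ (by linarith) h₄ 2
      _ = 16 * K ^ 2 * (n : ℝ) ^ 2 := by ring
      _ ≤ 16 * K ^ 2 * (P.graph.vol x R * (D + 1) ^ 2) :=
        mul_le_mul_of_nonneg_left h₃ (by positivity)
      _ = _ := by ring

end PennyConfiguration

/-! ### The three volume estimates -/

theorem theorem3p5 (D : ℕ) :
    ∃ C₁ C₂ C₃ C₄ : ℝ, 0 < C₁ ∧ 0 < C₂ ∧ 0 < C₃ ∧ 0 < C₄ ∧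
      ∀ (V : Type*) [Infinite V] (P : PennyConfiguration V),
        P.graph.Connected →
        (∀ σ ∈ P.faces, P.facialDegree σ ≤ (D : ℕ∞)) →
          P.graph.VolumeDoubling C₁ ∧
          P.graph.WeakRelativeVolumeComparison C₂ 2 ∧
          ∀ (x : V) (R : ℝ), 1 ≤ R →
            (P.graph.combBall x R).Finite ∧
            C₃ * R ^ 2 ≤ P.graph.vol x R ∧ P.graph.vol x R ≤ C₄ * R ^ 2 := by
  obtain ⟨c, hc⟩ : ∃ c : ℝ,
      c = 1 / (16 * ((D : ℝ) * (2 * D + 5) ^ 2 + 1) ^ 2 * (D + 1) ^ 2) := ⟨_, rfl⟩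
  have hcpos : 0 < c := by rw [hc]; positivity
  -- For `R ≥ 1`, `(2 * R + 1) ^ 2 ≤ 9 * R ^ 2`, and doubling the radius turns `9` into `36`. The
  -- summands divided by `c` serve inner radius at least `1`, where the lower bound applies; the
  -- others serve inner radius at most `1`, where `1 ≤ vol` is used.
  refine ⟨36 / c + 36, 9 / c + 9, c, 9, by positivity, by positivity, hcpos, by norm_num, ?_⟩
  intro V _ P hconn hD
  have hlow : ∀ (x : V) (R : ℝ), 1 ≤ R → c * R ^ 2 ≤ P.graph.vol x R := fun x R hR =>
    hc ▸ PennyConfiguration.mul_sq_le_vol hconn hD x hR rfl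
  have hup : ∀ (x : V) (R : ℝ), 1 ≤ R → P.graph.vol x R ≤ 9 * R ^ 2 := fun x R hR =>
    (PennyConfiguration.vol_le hconn x (by linarith)).trans (by nlinarith)
  refine ⟨fun x R hR => ?_, fun x R r hr hrR => ?_, fun x R hR =>
    ⟨PennyConfiguration.combBall_finite hconn x R, hlow x R hR, hup x R hR⟩⟩
  · have h₁ := PennyConfiguration.one_le_vol hconn x hR.le
    rw [add_mul]
    rcases le_total 1 R with h | h
    · have h₂ := hup x (2 * R) (by linarith)
      have h₃ : 36 / c * (c * R ^ 2) ≤ 36 / c * P.graph.vol x R :=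
        mul_le_mul_of_nonneg_left (hlow x R h) (by positivity)
      rw [← mul_assoc, div_mul_cancel₀ _ hcpos.ne'] at h₃
      nlinarith
    · have h₂ := (PennyConfiguration.vol_mono hconn x (show 2 * R ≤ 2 by linarith)).trans
        (hup x 2 (by norm_num))
      have h₃ : 0 ≤ 36 / c * P.graph.vol x R := by positivity
      linarith
  · have h₁ := PennyConfiguration.one_le_vol hconn x hr.le
    rw [Real.rpow_two, div_pow, ← mul_div_assoc, div_le_div_iff₀ (by linarith) (by positivity)]
    have hR2 : r ^ 2 ≤ R ^ 2 := pow_le_pow_left₀ hr.le hrR.le 2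
    have hvR := PennyConfiguration.one_le_vol hconn x (hr.trans hrR).le
    rcases le_total 1 r with h | h
    · have h₂ := mul_le_mul (hup x R (by linarith)) (hlow x r h) (by positivity) (by positivity)
      have h₃ : P.graph.vol x R * r ^ 2 ≤ 9 / c * R ^ 2 * P.graph.vol x r := by
        rw [div_mul_eq_mul_div, div_mul_eq_mul_div, le_div_iff₀ hcpos]
        linarith
      nlinarith [mul_nonneg (sq_nonneg R) (zero_le_one.trans h₁)]
    · have hr2 : r ^ 2 ≤ 1 := pow_le_one₀ hr.le h
      have h₂ : P.graph.vol x R * r ^ 2 ≤ 9 * R ^ 2 := by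
        rcases le_total 1 R with h' | h'
        · exact (mul_le_of_le_one_right (by linarith) hr2).trans (hup x R h')
        · have h₃ := (PennyConfiguration.vol_mono hconn x h').trans (hup x 1 le_rfl)
          calc _ ≤ 9 * 1 ^ 2 * r ^ 2 := mul_le_mul_of_nonneg_right h₃ (sq_nonneg r)
            _ ≤ _ := by linarith
      have h₃ : 9 * R ^ 2 * 1 ≤ 9 * R ^ 2 * P.graph.vol x r :=
        mul_le_mul_of_nonneg_left h₁ (by positivity)
      have h₄ : 0 ≤ 9 / c * R ^ 2 * P.graph.vol x r := by positivity
      linarith
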